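/- Let $H$ be the distribution of a positive random variable $U$ with $k_1=\mathrm{E}\{U^{-1/2}\}<\infty$. For $\mu\in\mathbb{R}^p$, a positive definite $p\times p$ matrix $\Sigma$ and $\lambda\in\mathbb{R}^p$, let $\mathrm{SMSN}_p(\mu,\Sigma,\lambda;H)$ be the distribution on $\mathbb{R}^p$ with Lebesgue density $$f(y)=2\int_0^\infty \phi_p(y;\mu,u^{-1}\Sigma)\,\Phi\!\left(u^{1/2}\lambda^\top\Sigma^{-1/2}(y-\mu)\right)dH(u),$$ where $\phi_p(\cdot;\mu,\Sigma)$ is the $\mathrm{N}_p(\mu,\Sigma)$ density, $\Phi$ is the standard normal cdf, $\Sigma^{1/2}$ is the positive definite square root and $\Sigma^{-1/2}$ its inverse. For subjects $i=1,\dots,N$ consider the linear mixed model $Y_i=X_i\beta+Z_ib_i+\epsilon_i$ with $X_i\in\mathbb{R}^{n_i\times l}$, $Z_i\in\mathbb{R}^{n_i\times q}$, $\beta\in\mathbb{R}^l$, where the vectors $(b_i^\top,\epsilon_i^\top)^\top$, $i=1,\dots,N$, are independent and $$\begin{pmatrix}b_i\\ \epsilon_i\end{pmatrix}\sim \mathrm{SMSN}_{q+n_i}\left(\begin{pmatrix}c\Delta\\0\end{pmatrix},\begin{pmatrix}D&0\\0&\Sigma_i\end{pmatrix},\begin{pmatrix}\lambda\\0\end{pmatrix};H\right),$$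 with $D$ ($q\times q$) and $\Sigma_i$ ($n_i\times n_i$) positive definite, $\lambda\in\mathbb{R}^q$, $c=-\sqrt{2/\pi}\,k_1$, $\Delta=D^{1/2}\delta$ and $\delta=\lambda/\sqrt{1+\lambda^\top\lambda}$. Then $Y_1,\dots,Y_N$ are independent and, for every $i$, $$Y_i\sim \mathrm{SMSN}_{n_i}(X_i\beta+cZ_i\Delta,\ \Psi_i,\ \bar\lambda_i;H),\qquad \Psi_i=\Sigma_i+Z_iDZ_i^\top,\qquad \bar\lambda_i=\frac{\Psi_i^{-1/2}Z_iD\zeta}{\sqrt{1+\zeta^\top\Lambda_i\zeta}},$$ where $\zeta=D^{-1/2}\lambda$ and $\Lambda_i=(D^{-1}+Z_i^\top\Sigma_i^{-1}Z_i)^{-1}$. Hence $Y_i$ has a Lebesgue density, which is given for almost every $y\in\mathbb{R}^{n_i}$ by $$f(y)=2\int_0^\infty\phi_{n_i}(y;X_i\beta+cZ_i\Delta,u^{-1}\Psi_i)\,\Phi\!\left(u^{1/2}\bar\lambda_i^\top\Psi_i^{-1/2}(y-X_i\beta-cZ_i\Delta)\right)dH(u).$$ -/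

import Mathlib

/-!
A skew-normal density `2 φ(x; 0, V) Φ(αᵀ x)` is the law of `x ∼ N(0, V)` conditioned on
`z ≤ αᵀ x`, where `z` is an independent standard normal variable. For a linear map `A`, the pair
`(A x, z - αᵀ x)` is again Gaussian. If `β` solves the normal equations `A V Aᵀ β = A V α`, then
`z - αᵀ x = (z - (α - Aᵀ β)ᵀ x) - βᵀ (A x)`, where the bracket is independent of `A x` and has
variance `1 + (α - Aᵀ β)ᵀ V (α - Aᵀ β)`. Dividing by its standard deviation shows that `A x` is
skew-normal, with shape vector proportional to `β`. Mixing over the scale `u^{-1/2}` commutes with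
linear maps, so scale mixtures are closed under affine maps of full row rank.

The response is `Y = X β + [Z I] (b, ε)`. For this map the residual variance
`(α - Aᵀ β)ᵀ V (α - Aᵀ β)` is `ζᵀ Λ ζ`, by Woodbury's identity.
-/

open MeasureTheory ProbabilityTheory Matrix
open scoped MatrixOrder

/-- The cdf `Φ` of the standard normal distribution on the line. -/
noncomputable def stdNormalCdf (x : ℝ) : ℝ := cdf (gaussianReal 0 1) x

/-- The density `φ_p(y; μ, S)` of the `p`-variate normal distribution with mean vector `μ` and
(positive definite) covariance matrix `S`, where `p` is the number of elements of `ι`. -/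
noncomputable def normalPdf {ι : Type*} [Fintype ι] [DecidableEq ι]
    (μ : ι → ℝ) (S : Matrix ι ι ℝ) (y : ι → ℝ) : ℝ :=
  (√((2 * Real.pi) ^ Fintype.card ι * S.det))⁻¹ *
    Real.exp (-(1 / 2) * ((y - μ) ⬝ᵥ S⁻¹ *ᵥ (y - μ)))

/-- `S^{1/2}`: the positive semidefinite square root of a positive semidefinite matrix. -/
noncomputable def matSqrt {ι : Type*} [Fintype ι] [DecidableEq ι]
    (S : Matrix ι ι ℝ) : Matrix ι ι ℝ := CFC.sqrt S

/-- `S^{-1/2}`: the inverse of the square root of a positive definite matrix. -/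
noncomputable def matInvSqrt {ι : Type*} [Fintype ι] [DecidableEq ι]
    (S : Matrix ι ι ℝ) : Matrix ι ι ℝ := (matSqrt S)⁻¹

/-- The density of the scale mixture of skew-normal distributions with location `μ`, dispersion
matrix `S`, skewness vector `lam`, mixing distribution `H` and weight function `κ(u) = 1/u`:
`f(y) = 2 ∫_0^∞ φ_p(y; μ, u⁻¹ S) Φ(u^{1/2} lamᵀ S^{-1/2} (y - μ)) dH(u)`.
The integrand is nonnegative, and the integral is taken in `[0, ∞]` (it may be infinite at the one
point `y = μ`). -/
noncomputable def smsnPdf {ι : Type*} [Fintype ι] [DecidableEq ι]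
    (μ : ι → ℝ) (S : Matrix ι ι ℝ) (lam : ι → ℝ) (H : Measure ℝ) (y : ι → ℝ) : ENNReal :=
  2 * ∫⁻ u in Set.Ioi (0 : ℝ),
    ENNReal.ofReal (normalPdf μ (u⁻¹ • S) y *
      stdNormalCdf (√u * (lam ⬝ᵥ matInvSqrt S *ᵥ (y - μ)))) ∂H

/-- The distribution `SMSN_p(μ, S, lam; H)` on `ℝ^p`: the measure with density `smsnPdf` with
respect to Lebesgue measure. -/
noncomputable def smsn {ι : Type*} [Fintype ι] [DecidableEq ι]
    (μ : ι → ℝ) (S : Matrix ι ι ℝ) (lam : ι → ℝ) (H : Measure ℝ) : Measure (ι → ℝ) :=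
  (volume : Measure (ι → ℝ)).withDensity (smsnPdf μ S lam H)

/-- `δ = λ / √(1 + λᵀ λ)`. -/
noncomputable def skewDelta {ι : Type*} [Fintype ι] (lam : ι → ℝ) : ι → ℝ :=
  (√(1 + lam ⬝ᵥ lam))⁻¹ • lam

/-- `Δ = D^{1/2} δ`. -/
noncomputable def bigDelta {ι : Type*} [Fintype ι] [DecidableEq ι]
    (D : Matrix ι ι ℝ) (lam : ι → ℝ) : ι → ℝ :=
  matSqrt D *ᵥ skewDelta lam

/-- `c = -√(2/π) k₁`, where `k₁ = E[U^{-1/2}]` for `U ∼ H`. -/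
noncomputable def centering (H : Measure ℝ) : ℝ :=
  -√(2 / Real.pi) * ∫ u, (√u)⁻¹ ∂H

/-- `Ψ = Σ + Z D Zᵀ`. -/
def margDispersion {m q : ℕ} (D : Matrix (Fin q) (Fin q) ℝ) (S : Matrix (Fin m) (Fin m) ℝ)
    (Z : Matrix (Fin m) (Fin q) ℝ) : Matrix (Fin m) (Fin m) ℝ :=
  S + Z * D * Zᵀ

/-- `Λ = (D⁻¹ + Zᵀ Σ⁻¹ Z)⁻¹`. -/
noncomputable def bigLambda {m q : ℕ} (D : Matrix (Fin q) (Fin q) ℝ)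
    (S : Matrix (Fin m) (Fin m) ℝ) (Z : Matrix (Fin m) (Fin q) ℝ) : Matrix (Fin q) (Fin q) ℝ :=
  (D⁻¹ + Zᵀ * S⁻¹ * Z)⁻¹

/-- `ζ = D^{-1/2} λ`. -/
noncomputable def zetaVec {q : ℕ} (D : Matrix (Fin q) (Fin q) ℝ) (lam : Fin q → ℝ) : Fin q → ℝ :=
  matInvSqrt D *ᵥ lam

/-- `λ̄ = Ψ^{-1/2} Z D ζ / √(1 + ζᵀ Λ ζ)`. -/
noncomputable def margSkewness {m q : ℕ} (D : Matrix (Fin q) (Fin q) ℝ)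
    (S : Matrix (Fin m) (Fin m) ℝ) (Z : Matrix (Fin m) (Fin q) ℝ) (lam : Fin q → ℝ) :
    Fin m → ℝ :=
  (√(1 + zetaVec D lam ⬝ᵥ bigLambda D S Z *ᵥ zetaVec D lam))⁻¹ •
    (matInvSqrt (margDispersion D S Z) * Z * D) *ᵥ zetaVec D lam

/-- The location vector `X β + c Z Δ` of the response. -/
noncomputable def margLocation {m l q : ℕ} (X : Matrix (Fin m) (Fin l) ℝ) (β : Fin l → ℝ)
    (Z : Matrix (Fin m) (Fin q) ℝ) (D : Matrix (Fin q) (Fin q) ℝ) (lam : Fin q → ℝ)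
    (H : Measure ℝ) : Fin m → ℝ :=
  X *ᵥ β + centering H • Z *ᵥ bigDelta D lam

section Gaussian

lemma ofReal_stdNormalCdf (x : ℝ) :
    ENNReal.ofReal (stdNormalCdf x) = gaussianReal 0 1 (Set.Iic x) :=
  ofReal_cdf _ x

@[fun_prop]
lemma measurable_stdNormalCdf : Measurable stdNormalCdf :=
  (monotone_cdf _).measurable

variable {ι : Type*} [Fintype ι] [DecidableEq ι]

lemma normalPdf_nonneg (μ : ι → ℝ) (S : Matrix ι ι ℝ) (y : ι → ℝ) : 0 ≤ normalPdf μ S y := by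
  unfold normalPdf; positivity

@[fun_prop]
lemma continuous_normalPdf (μ : ι → ℝ) (S : Matrix ι ι ℝ) : Continuous (normalPdf μ S) := by
  unfold normalPdf; fun_prop

lemma normalPdf_zero_one (x : ι → ℝ) :
    normalPdf 0 1 x = ∏ i, gaussianPDFReal 0 1 (x i) := by
  have hsqrt : √((2 * Real.pi) ^ Fintype.card ι) = √(2 * Real.pi) ^ Fintype.card ι := by
    rw [Real.sqrt_eq_iff_mul_self_eq (by positivity) (by positivity), ← mul_pow,
      Real.mul_self_sqrt (by positivity)]
  have hexp : -(1 / 2) * (x ⬝ᵥ x) = ∑ i, -x i ^ 2 / 2 := by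
    rw [dotProduct, Finset.mul_sum]
    exact Finset.sum_congr rfl fun i _ => by ring
  simp only [normalPdf, gaussianPDFReal, Finset.prod_mul_distrib, ← Real.exp_sum,
    Finset.prod_const, Finset.card_univ, det_one, inv_one, one_mulVec, sub_zero, mul_one,
    NNReal.coe_one, hsqrt, hexp, inv_pow]

lemma withDensity_normalPdf_zero_one :
    volume.withDensity (fun x : ι → ℝ => ENNReal.ofReal (normalPdf 0 1 x)) =
      Measure.pi fun _ : ι => gaussianReal 0 1 := by
  refine (Measure.pi_eq fun s hs => ?_).symm
  have hrestrict : (volume : Measure (ι → ℝ)).restrict (Set.univ.pi s) =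
      Measure.pi fun i => (volume : Measure ℝ).restrict (s i) := Measure.restrict_pi_pi _ s
  have hint : Integrable (fun x : ι → ℝ => ∏ i, gaussianPDFReal 0 1 (x i))
      (Measure.pi fun i => (volume : Measure ℝ).restrict (s i)) :=
    Integrable.fintype_prod fun i => (integrable_gaussianPDFReal 0 1).restrict
  simp only [withDensity_apply _ (MeasurableSet.univ_pi hs), hrestrict, normalPdf_zero_one]
  rw [← ofReal_integral_eq_lintegral_ofReal hint <| .of_forall fun x =>
      Finset.prod_nonneg fun i _ => gaussianPDFReal_nonneg _ _ _,
    integral_fintype_prod_eq_prod, ENNReal.ofReal_prod_of_nonneg fun i _ =>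
      integral_nonneg fun x => gaussianPDFReal_nonneg _ _ _]
  exact Finset.prod_congr rfl fun i _ => (gaussianReal_apply_eq_integral 0 one_ne_zero (s i)).symm

end Gaussian

section MatSqrt

variable {ι : Type*} [Fintype ι] [DecidableEq ι] {V : Matrix ι ι ℝ}

lemma matSqrt_mul_self (hV : V.PosSemidef) : matSqrt V * matSqrt V = V :=
  CFC.sqrt_mul_sqrt_self V hV.nonneg

lemma posSemidef_matSqrt (V : Matrix ι ι ℝ) : (matSqrt V).PosSemidef :=
  (CFC.sqrt_nonneg V).posSemidef

lemma transpose_matSqrt (V : Matrix ι ι ℝ) : (matSqrt V)ᵀ = matSqrt V :=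
  (posSemidef_matSqrt V).isHermitian

lemma isUnit_det_matSqrt (hV : V.PosDef) : IsUnit (matSqrt V).det := by
  rw [← Matrix.isUnit_iff_isUnit_det]
  exact (CFC.isUnit_sqrt_iff V hV.posSemidef.nonneg).2 hV.isUnit

lemma matSqrt_mul_matInvSqrt (hV : V.PosDef) : matSqrt V * matInvSqrt V = 1 :=
  Matrix.mul_nonsing_inv _ (isUnit_det_matSqrt hV)

lemma matInvSqrt_mul_matSqrt (hV : V.PosDef) : matInvSqrt V * matSqrt V = 1 :=
  Matrix.nonsing_inv_mul _ (isUnit_det_matSqrt hV)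

lemma transpose_matInvSqrt (V : Matrix ι ι ℝ) : (matInvSqrt V)ᵀ = matInvSqrt V := by
  rw [matInvSqrt, transpose_nonsing_inv, transpose_matSqrt]

lemma matInvSqrt_mul_self (hV : V.PosSemidef) : matInvSqrt V * matInvSqrt V = V⁻¹ := by
  rw [matInvSqrt, ← Matrix.mul_inv_rev, matSqrt_mul_self hV]

lemma matSqrt_sq_smul (hV : V.PosSemidef) {r : ℝ} (hr : 0 ≤ r) :
    matSqrt (r ^ 2 • V) = r • matSqrt V := by
  refine CFC.sqrt_unique ?_ ((posSemidef_matSqrt V).smul hr).nonneg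
  rw [smul_mul_smul_comm, matSqrt_mul_self hV, sq]

end MatSqrt

section NormalLaw

variable {ι : Type*} [Fintype ι] [DecidableEq ι] {V : Matrix ι ι ℝ}

/-- The normal distribution on `ι → ℝ`: Mathlib's `multivariateGaussian`, which lives on
`EuclideanSpace ℝ ι`, transported along the identification with the plain function space. -/
noncomputable def normalLaw (μ : ι → ℝ) (V : Matrix ι ι ℝ) : Measure (ι → ℝ) :=
  (multivariateGaussian (WithLp.toLp 2 μ) V).map WithLp.ofLp

instance (μ : ι → ℝ) (V : Matrix ι ι ℝ) : IsProbabilityMeasure (normalLaw μ V) :=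
  Measure.isProbabilityMeasure_map (by fun_prop)

lemma normalLaw_eq_map_pi (μ : ι → ℝ) (V : Matrix ι ι ℝ) :
    normalLaw μ V =
      (Measure.pi fun _ : ι => gaussianReal 0 1).map fun w => μ + matSqrt V *ᵥ w := by
  rw [normalLaw, multivariateGaussian, ← map_pi_eq_stdGaussian, Measure.map_map, Measure.map_map]
  · rfl
  all_goals fun_prop

lemma normalLaw_sq_smul (μ : ι → ℝ) (hV : V.PosSemidef) {r : ℝ} (hr : 0 ≤ r) :
    normalLaw μ (r ^ 2 • V) = (normalLaw 0 V).map fun x => μ + r • x := by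
  rw [normalLaw_eq_map_pi, normalLaw_eq_map_pi, Measure.map_map (by fun_prop) (by fun_prop),
    matSqrt_sq_smul hV hr]
  simp [Function.comp_def, smul_mulVec]

lemma normalPdf_add_matSqrt_mulVec (μ : ι → ℝ) (hV : V.PosDef) (w : ι → ℝ) :
    normalPdf μ V (μ + matSqrt V *ᵥ w) = |(matSqrt V).det|⁻¹ * normalPdf 0 1 w := by
  have hcancel : matInvSqrt V *ᵥ (matSqrt V *ᵥ w) = w := by
    rw [mulVec_mulVec, matInvSqrt_mul_matSqrt hV, one_mulVec]
  have hquad : matSqrt V *ᵥ w ⬝ᵥ V⁻¹ *ᵥ (matSqrt V *ᵥ w) = w ⬝ᵥ w := by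
    rw [← matInvSqrt_mul_self hV.posSemidef, ← mulVec_mulVec, dotProduct_mulVec,
      ← mulVec_transpose, transpose_matInvSqrt, hcancel]
  have hdet : √V.det = |(matSqrt V).det| := by
    rw [← Real.sqrt_mul_self_eq_abs, ← det_mul, matSqrt_mul_self hV.posSemidef]
  simp only [normalPdf, add_sub_cancel_left, hquad, sub_zero, inv_one, one_mulVec, det_one, mul_one]
  rw [Real.sqrt_mul (by positivity), hdet, mul_inv]
  ring

lemma lintegral_add_matSqrt_mulVec (μ : ι → ℝ) (hV : V.PosDef) {f : (ι → ℝ) → ENNReal}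
    (hf : Measurable f) :
    ∫⁻ w, f (μ + matSqrt V *ᵥ w) = ENNReal.ofReal |(matSqrt V).det|⁻¹ * ∫⁻ x, f x := by
  have hlin : Measurable (toLin' (matSqrt V)) :=
    (LinearMap.continuous_of_finiteDimensional _).measurable
  rw [← lintegral_add_left_eq_self f μ, ← smul_eq_mul, ← abs_inv, ← lintegral_smul_measure,
    ← Real.map_matrix_volume_pi_eq_smul_volume_pi (isUnit_det_matSqrt hV).ne_zero,
    lintegral_map (by fun_prop) hlin]
  rfl

lemma withDensity_normalPdf (μ : ι → ℝ) (hV : V.PosDef) :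
    volume.withDensity (fun x => ENNReal.ofReal (normalPdf μ V x)) = normalLaw μ V := by
  set T : (ι → ℝ) → ι → ℝ := fun w => μ + matSqrt V *ᵥ w
  have hTm : Measurable T := by fun_prop
  have hpdf : Measurable fun x => ENNReal.ofReal (normalPdf μ V x) := by fun_prop
  have hdet : 0 < |(matSqrt V).det|⁻¹ := inv_pos.2 (abs_pos.2 (isUnit_det_matSqrt hV).ne_zero)
  ext s hs
  refine (ENNReal.mul_right_inj (ENNReal.ofReal_pos.2 hdet).ne' ENNReal.ofReal_ne_top).1 ?_
  rw [withDensity_apply _ hs, ← lintegral_indicator hs,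
    ← lintegral_add_matSqrt_mulVec μ hV (hpdf.indicator hs), normalLaw_eq_map_pi,
    Measure.map_apply hTm hs, ← withDensity_normalPdf_zero_one, withDensity_apply _ (hTm hs),
    ← lintegral_indicator (hTm hs), ← lintegral_const_mul' _ _ ENNReal.ofReal_ne_top]
  refine lintegral_congr fun w => ?_
  by_cases hw : T w ∈ s
  · rw [Set.indicator_of_mem hw, Set.indicator_of_mem (s := T ⁻¹' s) hw,
      normalPdf_add_matSqrt_mulVec μ hV, ENNReal.ofReal_mul hdet.le]
  · rw [Set.indicator_of_notMem hw, Set.indicator_of_notMem (s := T ⁻¹' s) hw, mul_zero]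

end NormalLaw

section CharFun

variable {ι κ : Type*} [Fintype ι] [Fintype κ]

lemma ext_of_integral_cexp_dotProduct_add_mul {P Q : Measure ((ι → ℝ) × ℝ)} [IsFiniteMeasure P]
    [IsFiniteMeasure Q]
    (h : ∀ (s : ι → ℝ) (r : ℝ), ∫ p, Complex.exp ((s ⬝ᵥ p.1 + r * p.2 : ℝ) * Complex.I) ∂P =
      ∫ p, Complex.exp ((s ⬝ᵥ p.1 + r * p.2 : ℝ) * Complex.I) ∂Q) :
    P = Q := by
  classical
  refine Measure.ext_of_charFunDual (funext fun L => ?_)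
  obtain ⟨s, r, hL⟩ : ∃ (s : ι → ℝ) (r : ℝ), ∀ p, L p = s ⬝ᵥ p.1 + r * p.2 := by
    refine ⟨fun i => L (Pi.single i 1, 0), L (0, 1), fun p => ?_⟩
    have hp : p = ∑ i, p.1 i • (Pi.single i 1, 0) + p.2 • ((0, 1) : (ι → ℝ) × ℝ) := by
      ext j
      · simp [Prod.fst_sum, Finset.sum_apply, Pi.single_apply]
      · simp [Prod.snd_sum]
    conv_lhs => rw [hp]
    simp only [map_add, map_sum, map_smul, smul_eq_mul, dotProduct, mul_comm (p.1 _), mul_comm p.2]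
  simpa only [charFunDual_apply, hL] using h s r

lemma sub_dotProduct_mulVec_sub {M : Matrix ι ι ℝ} (hM : Mᵀ = M) (a b : ι → ℝ) :
    (a - b) ⬝ᵥ M *ᵥ (a - b) = a ⬝ᵥ M *ᵥ a - 2 * (a ⬝ᵥ M *ᵥ b) + b ⬝ᵥ M *ᵥ b := by
  have hsymm : b ⬝ᵥ M *ᵥ a = a ⬝ᵥ M *ᵥ b := by
    rw [dotProduct_mulVec, ← mulVec_transpose, hM, dotProduct_comm]
  rw [mulVec_sub, dotProduct_sub, sub_dotProduct, sub_dotProduct, hsymm]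
  ring

lemma transpose_mulVec_dotProduct (A : Matrix κ ι ℝ) (s : κ → ℝ) (x : ι → ℝ) :
    Aᵀ *ᵥ s ⬝ᵥ x = s ⬝ᵥ A *ᵥ x := by
  rw [mulVec_transpose, dotProduct_mulVec]

lemma dotProduct_mulVec_eq_residual_add {V : Matrix ι ι ℝ} {A : Matrix κ ι ℝ} {α : ι → ℝ}
    {β : κ → ℝ} (hV : Vᵀ = V)
    (hβ : (A * V * Aᵀ) *ᵥ β = (A * V) *ᵥ α) :
    α ⬝ᵥ V *ᵥ α =
      (α - Aᵀ *ᵥ β) ⬝ᵥ V *ᵥ (α - Aᵀ *ᵥ β) + β ⬝ᵥ (A * V * Aᵀ) *ᵥ β := by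
  have hcross : Aᵀ *ᵥ β ⬝ᵥ V *ᵥ α = β ⬝ᵥ (A * V * Aᵀ) *ᵥ β := by
    rw [transpose_mulVec_dotProduct, mulVec_mulVec, hβ]
  have hself : Aᵀ *ᵥ β ⬝ᵥ V *ᵥ (Aᵀ *ᵥ β) = β ⬝ᵥ (A * V * Aᵀ) *ᵥ β := by
    rw [transpose_mulVec_dotProduct, mulVec_mulVec, mulVec_mulVec, Matrix.mul_assoc]
  rw [← neg_sub, neg_dotProduct, mulVec_neg, dotProduct_neg, neg_neg,
    sub_dotProduct_mulVec_sub hV, hcross, hself]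
  ring

variable [DecidableEq ι] {V : Matrix ι ι ℝ}

lemma integral_cexp_dotProduct_normalLaw (μ : ι → ℝ) (hV : V.PosSemidef) (t : ι → ℝ) :
    ∫ x, Complex.exp ((t ⬝ᵥ x : ℝ) * Complex.I) ∂normalLaw μ V =
      Complex.exp ((t ⬝ᵥ μ : ℝ) * Complex.I - (t ⬝ᵥ V *ᵥ t : ℝ) / 2) := by
  have h := charFun_multivariateGaussian (μ := WithLp.toLp 2 μ) hV (WithLp.toLp 2 t)
  rw [charFun_apply] at h
  rw [normalLaw, integral_map (by fun_prop) (by fun_prop)]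
  simpa [EuclideanSpace.inner_eq_star_dotProduct, dotProduct_comm] using h

lemma integral_cexp_normalLaw_prod_gaussianReal (hV : V.PosSemidef) (t : ι → ℝ) (r : ℝ) :
    ∫ p, Complex.exp ((t ⬝ᵥ p.1 + r * p.2 : ℝ) * Complex.I)
        ∂(normalLaw 0 V).prod (gaussianReal 0 1) =
      Complex.exp (-(t ⬝ᵥ V *ᵥ t + r ^ 2 : ℝ) / 2) := by
  have hr := charFun_gaussianReal (μ := 0) (v := 1) r
  rw [charFun_apply_real] at hr
  simp only [Complex.ofReal_add, add_mul, Complex.exp_add, Complex.ofReal_mul]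
  rw [integral_prod_mul (fun x : ι → ℝ => Complex.exp ((t ⬝ᵥ x : ℝ) * Complex.I))
    (fun z : ℝ => Complex.exp (r * z * Complex.I)), hr, integral_cexp_dotProduct_normalLaw 0 hV,
    ← Complex.exp_add]
  congr 1
  simp
  ring

end CharFun

section SkewNormal

variable {ι κ : Type*} [Fintype ι] [Fintype κ] [DecidableEq ι] [DecidableEq κ]

/-- The centred skew-normal distribution with dispersion matrix `V` and Azzalini shape vector `α`,
whose density at `x` is `2 φ(x; 0, V) Φ(αᵀ x)`. It is encoded by its selection representation, the
law of `x ∼ N(0, V)` conditioned on `z ≤ αᵀ x` for an independent standard normal `z`; that event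
has probability `1 / 2`. -/
noncomputable def skewNormal (V : Matrix ι ι ℝ) (α : ι → ℝ) : Measure (ι → ℝ) :=
  (2 : ENNReal) • (((normalLaw 0 V).prod (gaussianReal 0 1)).restrict
    {p | p.2 ≤ α ⬝ᵥ p.1}).map Prod.fst

instance (V : Matrix ι ι ℝ) (α : ι → ℝ) : IsFiniteMeasure (skewNormal V α) :=
  Measure.smul_finite _ ENNReal.ofNat_ne_top

lemma skewNormal_eq_withDensity (V : Matrix ι ι ℝ) (α : ι → ℝ) :
    skewNormal V α =
      (normalLaw 0 V).withDensity fun x => 2 * ENNReal.ofReal (stdNormalCdf (α ⬝ᵥ x)) := by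
  have hdot : Measurable fun x : ι → ℝ => α ⬝ᵥ x := Continuous.measurable (by fun_prop)
  have hE : MeasurableSet {p : (ι → ℝ) × ℝ | p.2 ≤ α ⬝ᵥ p.1} :=
    measurableSet_le measurable_snd (hdot.comp measurable_fst)
  ext s hs
  rw [skewNormal, Measure.smul_apply, Measure.map_apply measurable_fst hs,
    Measure.restrict_apply (measurable_fst hs), Measure.prod_apply ((measurable_fst hs).inter hE),
    withDensity_apply _ hs, lintegral_const_mul _ (by fun_prop), smul_eq_mul,
    ← lintegral_indicator hs]
  congr 1
  refine lintegral_congr fun x => ?_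
  by_cases hx : x ∈ s
  · rw [Set.indicator_of_mem hx, ofReal_stdNormalCdf]
    congr 1
    ext z
    simp [hx]
  · rw [Set.indicator_of_notMem hx]
    exact measure_mono_null (fun z hz => hx hz.1) measure_empty

variable {V : Matrix ι ι ℝ} {A : Matrix κ ι ℝ} {α : ι → ℝ} {β : κ → ℝ}

/-- Both sides are centred Gaussian, so the hypotheses say precisely that the covariances agree. -/
lemma map_normalLaw_prod_gaussianReal (hV : V.PosSemidef)
    (hβ : (A * V * Aᵀ) *ᵥ β = (A * V) *ᵥ α) {c : ℝ}
    (hc : c ^ 2 * (1 + (α - Aᵀ *ᵥ β) ⬝ᵥ V *ᵥ (α - Aᵀ *ᵥ β)) = 1) :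
    ((normalLaw 0 V).prod (gaussianReal 0 1)).map
        (fun p => (A *ᵥ p.1, c * (p.2 - α ⬝ᵥ p.1))) =
      ((normalLaw 0 (A * V * Aᵀ)).prod (gaussianReal 0 1)).map
        (fun p => (p.1, p.2 - (c • β) ⬝ᵥ p.1)) := by
  have hVt : Vᵀ = V := hV.isHermitian
  have hAV : (A * V * Aᵀ).PosSemidef := hV.mul_mul_conjTranspose_same A
  have hAVt : (A * V * Aᵀ)ᵀ = A * V * Aᵀ := hAV.isHermitian
  refine ext_of_integral_cexp_dotProduct_add_mul fun s r => ?_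
  have hleft : ∀ p : (ι → ℝ) × ℝ, s ⬝ᵥ A *ᵥ p.1 + r * (c * (p.2 - α ⬝ᵥ p.1)) =
      (Aᵀ *ᵥ s - (r * c) • α) ⬝ᵥ p.1 + r * c * p.2 := fun p => by
    rw [sub_dotProduct, transpose_mulVec_dotProduct, smul_dotProduct, smul_eq_mul]; ring
  have hright : ∀ p : (κ → ℝ) × ℝ, s ⬝ᵥ p.1 + r * (p.2 - (c • β) ⬝ᵥ p.1) =
      (s - (r * c) • β) ⬝ᵥ p.1 + r * p.2 := fun p => by
    rw [sub_dotProduct, smul_dotProduct, smul_dotProduct, smul_eq_mul, smul_eq_mul]; ring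
  rw [integral_map (Continuous.aemeasurable (by fun_prop)) (by fun_prop),
    integral_map (Continuous.aemeasurable (by fun_prop)) (by fun_prop)]
  simp only [hleft, hright]
  rw [integral_cexp_normalLaw_prod_gaussianReal hV, integral_cexp_normalLaw_prod_gaussianReal hAV]
  congr 4
  have hss : Aᵀ *ᵥ s ⬝ᵥ V *ᵥ (Aᵀ *ᵥ s) = s ⬝ᵥ (A * V * Aᵀ) *ᵥ s := by
    rw [transpose_mulVec_dotProduct, mulVec_mulVec, mulVec_mulVec, Matrix.mul_assoc]
  have hsα : Aᵀ *ᵥ s ⬝ᵥ V *ᵥ α = s ⬝ᵥ (A * V * Aᵀ) *ᵥ β := by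
    rw [transpose_mulVec_dotProduct, mulVec_mulVec, hβ]
  rw [sub_dotProduct_mulVec_sub hVt, sub_dotProduct_mulVec_sub hAVt]
  simp only [mulVec_smul, dotProduct_smul, smul_dotProduct, smul_eq_mul, hss, hsα,
    dotProduct_mulVec_eq_residual_add hVt hβ]
  linear_combination r ^ 2 * hc

/-- Conditioning on `z ≤ αᵀ x` is conditioning on `c (z - αᵀ x) ≤ 0` for any `c > 0`. -/
lemma map_skewNormal (hV : V.PosSemidef) (hβ : (A * V * Aᵀ) *ᵥ β = (A * V) *ᵥ α) :
    (skewNormal V α).map (A *ᵥ ·) = skewNormal (A * V * Aᵀ)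
      ((√(1 + (α - Aᵀ *ᵥ β) ⬝ᵥ V *ᵥ (α - Aᵀ *ᵥ β)))⁻¹ • β) := by
  set v := (α - Aᵀ *ᵥ β) ⬝ᵥ V *ᵥ (α - Aᵀ *ᵥ β)
  set c := (√(1 + v))⁻¹
  have hv : 0 ≤ v := hV.dotProduct_mulVec_nonneg (α - Aᵀ *ᵥ β)
  have hc : 0 < c := by positivity
  have hcv : c ^ 2 * (1 + v) = 1 := by
    rw [inv_pow, Real.sq_sqrt (by positivity), inv_mul_cancel₀ (by positivity)]
  set T : (ι → ℝ) × ℝ → (κ → ℝ) × ℝ := fun p => (A *ᵥ p.1, c * (p.2 - α ⬝ᵥ p.1))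
  set T' : (κ → ℝ) × ℝ → (κ → ℝ) × ℝ := fun p => (p.1, p.2 - (c • β) ⬝ᵥ p.1)
  have hT : Measurable T := Continuous.measurable (by fun_prop)
  have hT' : Measurable T' := Continuous.measurable (by fun_prop)
  have hN : MeasurableSet {p : (κ → ℝ) × ℝ | p.2 ≤ 0} := measurable_snd measurableSet_Iic
  have hevent : {p : (ι → ℝ) × ℝ | p.2 ≤ α ⬝ᵥ p.1} = T ⁻¹' {p | p.2 ≤ 0} := by
    ext p
    simp [T, mul_nonpos_iff_pos_imp_nonpos, hc, hc.le]
  have hevent' : {p : (κ → ℝ) × ℝ | p.2 ≤ (c • β) ⬝ᵥ p.1} = T' ⁻¹' {p | p.2 ≤ 0} := by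
    ext p
    simp [T']
  calc (skewNormal V α).map (A *ᵥ ·)
      = (2 : ENNReal) • ((((normalLaw 0 V).prod (gaussianReal 0 1)).map T).restrict
          {p | p.2 ≤ 0}).map Prod.fst := by
        rw [skewNormal, Measure.map_smul, Measure.map_map (by fun_prop) measurable_fst, hevent,
          Measure.restrict_map hT hN, Measure.map_map measurable_fst hT]
        rfl
    _ = (2 : ENNReal) • ((((normalLaw 0 (A * V * Aᵀ)).prod (gaussianReal 0 1)).map T').restrict
          {p | p.2 ≤ 0}).map Prod.fst := by
        rw [map_normalLaw_prod_gaussianReal hV hβ hcv]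
    _ = skewNormal (A * V * Aᵀ) (c • β) := by
        rw [skewNormal, hevent', Measure.restrict_map hT' hN, Measure.map_map measurable_fst hT']
        rfl

end SkewNormal

section SMSN

variable {ι κ : Type*} [Fintype ι] [Fintype κ] [DecidableEq ι] [DecidableEq κ]

lemma nonsing_inv_inv_smul {S : Matrix ι ι ℝ} (hS : IsUnit S.det) (u : ℝ) :
    (u⁻¹ • S)⁻¹ = u • S⁻¹ := by
  rcases eq_or_ne u 0 with rfl | hu
  · simp
  · refine Matrix.inv_eq_right_inv ?_
    rw [smul_mul_smul_comm, inv_mul_cancel₀ hu, one_smul, Matrix.mul_nonsing_inv _ hS]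

variable {S : Matrix ι ι ℝ}

lemma measurable_smsn_integrand (μ : ι → ℝ) (hS : IsUnit S.det) (lam : ι → ℝ) :
    Measurable fun p : (ι → ℝ) × ℝ => ENNReal.ofReal (normalPdf μ (p.2⁻¹ • S) p.1 *
      stdNormalCdf (√p.2 * (lam ⬝ᵥ matInvSqrt S *ᵥ (p.1 - μ)))) := by
  have hlin : Measurable fun p : (ι → ℝ) × ℝ => lam ⬝ᵥ matInvSqrt S *ᵥ (p.1 - μ) :=
    Continuous.measurable (by fun_prop)
  have hquad : Measurable fun p : (ι → ℝ) × ℝ => (p.1 - μ) ⬝ᵥ S⁻¹ *ᵥ (p.1 - μ) :=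
    Continuous.measurable (by fun_prop)
  simp only [normalPdf, det_smul, nonsing_inv_inv_smul hS, smul_mulVec, dotProduct_smul,
    smul_eq_mul]
  fun_prop

lemma measurable_smsnPdf (μ : ι → ℝ) (hS : IsUnit S.det) (lam : ι → ℝ) (H : Measure ℝ)
    [SFinite H] : Measurable (smsnPdf μ S lam H) :=
  (measurable_smsn_integrand μ hS lam).lintegral_prod_right'.const_mul 2

lemma setLIntegral_smsn_integrand (μ : ι → ℝ) (hS : S.PosDef) (lam : ι → ℝ) {u : ℝ} (hu : 0 < u)
    {s : Set (ι → ℝ)} (hs : MeasurableSet s) :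
    2 * ∫⁻ y in s, ENNReal.ofReal (normalPdf μ (u⁻¹ • S) y *
        stdNormalCdf (√u * (lam ⬝ᵥ matInvSqrt S *ᵥ (y - μ)))) =
      skewNormal S (matInvSqrt S *ᵥ lam) ((fun x => μ + (√u)⁻¹ • x) ⁻¹' s) := by
  set T : (ι → ℝ) → ι → ℝ := fun x => μ + (√u)⁻¹ • x
  have hT : Measurable T := by fun_prop
  have hlin : Measurable fun y : ι → ℝ => lam ⬝ᵥ matInvSqrt S *ᵥ (y - μ) :=
    Continuous.measurable (by fun_prop)
  have hscale : normalLaw μ (u⁻¹ • S) = (normalLaw 0 S).map T := by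
    rw [← normalLaw_sq_smul μ hS.posSemidef (by positivity), inv_pow, Real.sq_sqrt hu.le]
  have harg : ∀ x, √u * (lam ⬝ᵥ matInvSqrt S *ᵥ (T x - μ)) = matInvSqrt S *ᵥ lam ⬝ᵥ x := fun x => by
    rw [add_sub_cancel_left, mulVec_smul, dotProduct_smul, smul_eq_mul,
      mul_inv_cancel_left₀ (by positivity), ← transpose_mulVec_dotProduct, transpose_matInvSqrt]
  simp only [ENNReal.ofReal_mul (normalPdf_nonneg _ _ _)]
  rw [← lintegral_const_mul _ (by fun_prop)]
  calc ∫⁻ y in s, 2 * (ENNReal.ofReal (normalPdf μ (u⁻¹ • S) y) *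
        ENNReal.ofReal (stdNormalCdf (√u * (lam ⬝ᵥ matInvSqrt S *ᵥ (y - μ)))))
      = ∫⁻ y in s, 2 * ENNReal.ofReal (stdNormalCdf (√u * (lam ⬝ᵥ matInvSqrt S *ᵥ (y - μ))))
          ∂normalLaw μ (u⁻¹ • S) := by
        rw [← withDensity_normalPdf μ (hS.smul (inv_pos.2 hu)),
          setLIntegral_withDensity_eq_setLIntegral_mul _ (by fun_prop) (by fun_prop) hs]
        simp only [Pi.mul_apply, mul_left_comm]
    _ = ∫⁻ x in T ⁻¹' s, 2 * ENNReal.ofReal (stdNormalCdf (matInvSqrt S *ᵥ lam ⬝ᵥ x))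
          ∂normalLaw 0 S := by
        rw [hscale, setLIntegral_map hs (by fun_prop) hT]
        simp only [harg]
    _ = skewNormal S (matInvSqrt S *ᵥ lam) (T ⁻¹' s) := by
        rw [skewNormal_eq_withDensity, withDensity_apply _ (hT hs)]

lemma smsn_eq_map_skewNormal (μ : ι → ℝ) (hS : S.PosDef) (lam : ι → ℝ) (H : Measure ℝ)
    [SFinite H] :
    smsn μ S lam H = ((H.restrict (Set.Ioi 0)).prod (skewNormal S (matInvSqrt S *ᵥ lam))).map
      fun p => μ + (√p.1)⁻¹ • p.2 := by
  have hm := measurable_smsn_integrand μ hS.det_pos.ne'.isUnit lam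
  have hT : Measurable fun p : ℝ × (ι → ℝ) => μ + (√p.1)⁻¹ • p.2 := by fun_prop
  ext s hs
  rw [smsn, withDensity_apply _ hs, Measure.map_apply hT hs, Measure.prod_apply (hT hs)]
  simp only [smsnPdf]
  rw [lintegral_const_mul _ hm.lintegral_prod_right', lintegral_lintegral_swap hm.aemeasurable,
    ← lintegral_const_mul _ hm.lintegral_prod_left']
  exact setLIntegral_congr_fun measurableSet_Ioi fun u hu =>
    setLIntegral_smsn_integrand μ hS lam hu hs

lemma mulVec_matInvSqrt_mulVec (hS : S.PosDef) (lam : ι → ℝ) :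
    S *ᵥ matInvSqrt S *ᵥ lam = matSqrt S *ᵥ lam := by
  nth_rw 1 [← matSqrt_mul_self hS.posSemidef]
  rw [mulVec_mulVec, Matrix.mul_assoc, matSqrt_mul_matInvSqrt hS, Matrix.mul_one]

lemma matInvSqrt_mulVec_dotProduct_mulVec (hS : S.PosDef) (lam : ι → ℝ) :
    matInvSqrt S *ᵥ lam ⬝ᵥ S *ᵥ matInvSqrt S *ᵥ lam = lam ⬝ᵥ lam := by
  rw [mulVec_matInvSqrt_mulVec hS, ← transpose_matInvSqrt, transpose_mulVec_dotProduct,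
    mulVec_mulVec, matInvSqrt_mul_matSqrt hS, one_mulVec]

/-- The skewness vector of `A w` when `w` has a scale mixture of skew-normal distributions with
dispersion matrix `S` and skewness vector `lam`. The radicand is one plus the residual variance in
the regression of the skewing direction of `w` on `A w`. -/
noncomputable def affineSkewness (A : Matrix κ ι ℝ) (S : Matrix ι ι ℝ) (lam : ι → ℝ) : κ → ℝ :=
  (√(1 + (lam ⬝ᵥ lam - (A * matSqrt S) *ᵥ lam ⬝ᵥ (A * S * Aᵀ)⁻¹ *ᵥ (A * matSqrt S) *ᵥ lam)))⁻¹ •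
    matInvSqrt (A * S * Aᵀ) *ᵥ (A * matSqrt S) *ᵥ lam

lemma map_skewNormal_matInvSqrt {A : Matrix κ ι ℝ} (hS : S.PosDef) (hA : (A * S * Aᵀ).PosDef)
    (lam : ι → ℝ) :
    (skewNormal S (matInvSqrt S *ᵥ lam)).map (A *ᵥ ·) =
      skewNormal (A * S * Aᵀ) (matInvSqrt (A * S * Aᵀ) *ᵥ affineSkewness A S lam) := by
  set Ψ := A * S * Aᵀ
  set w := (A * matSqrt S) *ᵥ lam
  set α := matInvSqrt S *ᵥ lam
  set β := Ψ⁻¹ *ᵥ w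
  have hSt : Sᵀ = S := hS.isHermitian
  have hΨβ : Ψ *ᵥ β = w := by
    rw [mulVec_mulVec, mul_nonsing_inv _ hA.det_pos.ne'.isUnit, one_mulVec]
  have hβ : Ψ *ᵥ β = (A * S) *ᵥ α := by
    rw [hΨβ, ← mulVec_mulVec, mulVec_matInvSqrt_mulVec hS, mulVec_mulVec]
  have hresidual : (α - Aᵀ *ᵥ β) ⬝ᵥ S *ᵥ (α - Aᵀ *ᵥ β) = lam ⬝ᵥ lam - w ⬝ᵥ β := by
    rw [← matInvSqrt_mulVec_dotProduct_mulVec hS, dotProduct_mulVec_eq_residual_add hSt hβ, hΨβ,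
      dotProduct_comm w, add_sub_cancel_right]
  rw [map_skewNormal hS.posSemidef hβ, hresidual, affineSkewness, mulVec_smul,
    mulVec_mulVec w, matInvSqrt_mul_self hA.posSemidef]

lemma map_smsn_affine {A : Matrix κ ι ℝ} (hS : S.PosDef) (hA : (A * S * Aᵀ).PosDef)
    (μ lam : ι → ℝ) (v : κ → ℝ) (H : Measure ℝ) [SFinite H] :
    (smsn μ S lam H).map (fun w => v + A *ᵥ w) =
      smsn (v + A *ᵥ μ) (A * S * Aᵀ) (affineSkewness A S lam) H := by
  rw [smsn_eq_map_skewNormal μ hS, smsn_eq_map_skewNormal _ hA, ← map_skewNormal_matInvSqrt hS hA,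
    Measure.map_map (by fun_prop) (by fun_prop)]
  nth_rw 2 [← Measure.map_id (μ := H.restrict (Set.Ioi 0))]
  rw [Measure.map_prod_map _ _ measurable_id (by fun_prop),
    Measure.map_map (by fun_prop) (by fun_prop)]
  congr 1
  ext1 p
  simp [mulVec_add, mulVec_smul, add_assoc]

end SMSN

section Blocks

variable {ι κ : Type*} {A : Matrix ι ι ℝ} {B : Matrix κ κ ℝ}

lemma posSemidef_fromBlocks_zero [Finite ι] [Finite κ] (hA : A.PosSemidef) (hB : B.PosSemidef) :
    (fromBlocks A 0 0 B).PosSemidef := by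
  have := Fintype.ofFinite ι
  have := Fintype.ofFinite κ
  refine .of_dotProduct_mulVec_nonneg (hA.isHermitian.fromBlocks (by simp) hB.isHermitian)
    fun x => ?_
  have hx : star x ⬝ᵥ fromBlocks A 0 0 B *ᵥ x =
      (x ∘ Sum.inl) ⬝ᵥ A *ᵥ (x ∘ Sum.inl) + (x ∘ Sum.inr) ⬝ᵥ B *ᵥ (x ∘ Sum.inr) := by
    simp [fromBlocks_mulVec, dotProduct]
  rw [hx]
  exact add_nonneg (hA.dotProduct_mulVec_nonneg _) (hB.dotProduct_mulVec_nonneg _)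

lemma posDef_fromBlocks_zero [Finite ι] [Finite κ] (hA : A.PosDef) (hB : B.PosDef) :
    (fromBlocks A 0 0 B).PosDef := by
  classical
  have := Fintype.ofFinite ι
  have := Fintype.ofFinite κ
  refine (posSemidef_fromBlocks_zero hA.posSemidef hB.posSemidef).posDef_iff_isUnit.2 ?_
  rw [Matrix.isUnit_iff_isUnit_det, det_fromBlocks_zero₂₁]
  exact (mul_pos hA.det_pos hB.det_pos).ne'.isUnit

lemma matSqrt_fromBlocks_zero [Fintype ι] [Fintype κ] [DecidableEq ι] [DecidableEq κ]
    (hA : A.PosSemidef) (hB : B.PosSemidef) :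
    matSqrt (fromBlocks A 0 0 B) = fromBlocks (matSqrt A) 0 0 (matSqrt B) := by
  refine CFC.sqrt_unique ?_
    (posSemidef_fromBlocks_zero (posSemidef_matSqrt A) (posSemidef_matSqrt B)).nonneg
  simp [fromBlocks_multiply, matSqrt_mul_self hA, matSqrt_mul_self hB]

end Blocks

section MixedModel

variable {m q : ℕ} {D : Matrix (Fin q) (Fin q) ℝ} {S : Matrix (Fin m) (Fin m) ℝ}

lemma posDef_margDispersion (hD : D.PosSemidef) (hS : S.PosDef) (Z : Matrix (Fin m) (Fin q) ℝ) :
    (margDispersion D S Z).PosDef :=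
  hS.add_posSemidef (hD.mul_mul_conjTranspose_same Z)

/-- The matrix `[Z I]`, which sends the stacked vector `(b, ε)` to `Z b + ε`. -/
def mixedDesign (Z : Matrix (Fin m) (Fin q) ℝ) : Matrix (Fin m) (Fin q ⊕ Fin m) ℝ :=
  fromCols Z 1

lemma mixedDesign_mulVec_sumElim (Z : Matrix (Fin m) (Fin q) ℝ) (x : Fin q → ℝ)
    (y : Fin m → ℝ) : mixedDesign Z *ᵥ Sum.elim x y = Z *ᵥ x + y := by
  rw [mixedDesign, fromCols_mulVec_sumElim, one_mulVec]

lemma mixedDesign_mul_fromBlocks_mul_transpose (D : Matrix (Fin q) (Fin q) ℝ)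
    (S : Matrix (Fin m) (Fin m) ℝ) (Z : Matrix (Fin m) (Fin q) ℝ) :
    mixedDesign Z * fromBlocks D 0 0 S * (mixedDesign Z)ᵀ = margDispersion D S Z := by
  rw [mixedDesign, fromCols_mul_fromBlocks, transpose_fromCols, fromCols_mul_fromRows]
  simp [margDispersion, add_comm]

/-- Woodbury's identity, read as the conditional covariance of the random effects. -/
lemma bigLambda_eq_sub (hD : D.PosDef) (hS : S.PosDef) (Z : Matrix (Fin m) (Fin q) ℝ) :
    bigLambda D S Z = D - D * Zᵀ * (margDispersion D S Z)⁻¹ * Z * D := by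
  have hDinv : D⁻¹⁻¹ = D := nonsing_inv_nonsing_inv D hD.det_pos.ne'.isUnit
  have hSinv : S⁻¹⁻¹ = S := nonsing_inv_nonsing_inv S hS.det_pos.ne'.isUnit
  have hunit : IsUnit (S⁻¹⁻¹ + Z * D⁻¹⁻¹ * Zᵀ) := by
    rw [hDinv, hSinv]
    exact (posDef_margDispersion hD.posSemidef hS Z).isUnit
  rw [bigLambda, add_mul_mul_inv_eq_sub D⁻¹ Zᵀ S⁻¹ Z hD.inv.isUnit hS.inv.isUnit hunit, hDinv,
    hSinv, margDispersion]

lemma affineSkewness_mixedDesign (hD : D.PosDef) (hS : S.PosDef) (Z : Matrix (Fin m) (Fin q) ℝ)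
    (lam : Fin q → ℝ) :
    affineSkewness (mixedDesign Z) (fromBlocks D 0 0 S) (Sum.elim lam 0) =
      margSkewness D S Z lam := by
  set ζ := zetaVec D lam with hζ
  have hDt : Dᵀ = D := hD.isHermitian
  have hsqrtζ : D *ᵥ ζ = matSqrt D *ᵥ lam := mulVec_matInvSqrt_mulVec hD lam
  have hw : (mixedDesign Z * matSqrt (fromBlocks D 0 0 S)) *ᵥ Sum.elim lam 0 = (Z * D) *ᵥ ζ := by
    rw [matSqrt_fromBlocks_zero hD.posSemidef hS.posSemidef, ← mulVec_mulVec, fromBlocks_mulVec,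
      mixedDesign_mulVec_sumElim]
    simp [← hsqrtζ, mulVec_mulVec]
  have hlam : ζ ⬝ᵥ D *ᵥ ζ = lam ⬝ᵥ lam := matInvSqrt_mulVec_dotProduct_mulVec hD lam
  have hvar : ζ ⬝ᵥ D *ᵥ ζ - (Z * D) *ᵥ ζ ⬝ᵥ (margDispersion D S Z)⁻¹ *ᵥ (Z * D) *ᵥ ζ =
      ζ ⬝ᵥ bigLambda D S Z *ᵥ ζ := by
    rw [bigLambda_eq_sub hD hS, sub_mulVec, dotProduct_sub, ← transpose_transpose (Z * D),
      transpose_mulVec_dotProduct, transpose_transpose, transpose_mul, hDt]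
    simp only [mulVec_mulVec, Matrix.mul_assoc]
  rw [affineSkewness, hw, mixedDesign_mul_fromBlocks_mul_transpose, sumElim_dotProduct_sumElim,
    dotProduct_zero, add_zero, ← hlam, hvar, margSkewness, ← hζ, mulVec_mulVec, Matrix.mul_assoc]

lemma map_smsn_mixedModel (hD : D.PosDef) (hS : S.PosDef) (Z : Matrix (Fin m) (Fin q) ℝ)
    (μ lam : Fin q → ℝ) (v : Fin m → ℝ) (H : Measure ℝ) [SFinite H] :
    (smsn (Sum.elim μ 0) (fromBlocks D 0 0 S) (Sum.elim lam 0) H).map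
        (fun w => v + mixedDesign Z *ᵥ w) =
      smsn (v + Z *ᵥ μ) (margDispersion D S Z) (margSkewness D S Z lam) H := by
  have hΨ := mixedDesign_mul_fromBlocks_mul_transpose D S Z
  have hpd := posDef_margDispersion hD.posSemidef hS Z
  rw [map_smsn_affine (posDef_fromBlocks_zero hD hS) (hΨ ▸ hpd), hΨ,
    affineSkewness_mixedDesign hD hS, mixedDesign_mulVec_sumElim,
    add_zero]

end MixedModel

section Density

variable {ι Ω : Type*} [Fintype ι] [DecidableEq ι] [MeasurableSpace Ω] {P : Measure Ω}
  {Y : Ω → ι → ℝ} {μ lam : ι → ℝ} {S : Matrix ι ι ℝ} {H : Measure ℝ} [SFinite H]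

lemma hasPDF_of_hasLaw_smsn (hS : IsUnit S.det) (hY : HasLaw Y (smsn μ S lam H) P) :
    HasPDF Y P volume :=
  hasPDF_of_map_eq_withDensity hY.aemeasurable _ (measurable_smsnPdf μ hS lam H).aemeasurable
    hY.map_eq

lemma pdf_ae_eq_smsnPdf (hS : IsUnit S.det) (hY : HasLaw Y (smsn μ S lam H) P) :
    pdf Y P volume =ᵐ[volume] smsnPdf μ S lam H :=
  have := hasPDF_of_hasLaw_smsn hS hY
  (pdf.eq_of_map_eq_withDensity' _ (measurable_smsnPdf μ hS lam H).aemeasurable).1 hY.map_eq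

end Density

theorem mainTheorem1_general
    {Ω I : Type*} [MeasurableSpace Ω] (P : Measure Ω) (q : ℕ) (n : I → ℕ)
    (H : Measure ℝ) [SFinite H] (Z : ∀ i, Matrix (Fin (n i)) (Fin q) ℝ)
    (v : ∀ i, Fin (n i) → ℝ) (μ lam : Fin q → ℝ)
    (D : Matrix (Fin q) (Fin q) ℝ) (hD : D.PosDef)
    (S : ∀ i, Matrix (Fin (n i)) (Fin (n i)) ℝ) (hS : ∀ i, (S i).PosDef)
    (b : I → Ω → Fin q → ℝ) (ε : ∀ i, Ω → Fin (n i) → ℝ) (Y : ∀ i, Ω → Fin (n i) → ℝ)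
    (hlaw : ∀ i, HasLaw (fun ω => Sum.elim (b i ω) (ε i ω))
      (smsn (Sum.elim μ 0) (fromBlocks D 0 0 (S i)) (Sum.elim lam 0) H) P)
    (hindep : iIndepFun
      (fun i ω => (Sum.elim (b i ω) (ε i ω) : Fin q ⊕ Fin (n i) → ℝ)) P)
    (hY : ∀ i ω, Y i ω = v i + Z i *ᵥ b i ω + ε i ω) :
    iIndepFun Y P ∧
    ∀ i,
      HasLaw (Y i) (smsn (v i + Z i *ᵥ μ) (margDispersion D (S i) (Z i))
        (margSkewness D (S i) (Z i) lam) H) P ∧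
      HasPDF (Y i) P volume ∧
      pdf (Y i) P volume =ᵐ[volume] smsnPdf (v i + Z i *ᵥ μ) (margDispersion D (S i) (Z i))
        (margSkewness D (S i) (Z i) lam) H := by
  set φ : ∀ i, (Fin q ⊕ Fin (n i) → ℝ) → Fin (n i) → ℝ := fun i w => v i + mixedDesign (Z i) *ᵥ w
  have hφ : ∀ i, Measurable (φ i) := fun i => Continuous.measurable (by fun_prop)
  have hYφ : ∀ i, Y i = φ i ∘ fun ω => Sum.elim (b i ω) (ε i ω) := fun i => funext fun ω => by
    simp [φ, hY i ω, mixedDesign_mulVec_sumElim, add_assoc]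
  have hlawY : ∀ i, HasLaw (Y i) (smsn (v i + Z i *ᵥ μ) (margDispersion D (S i) (Z i))
      (margSkewness D (S i) (Z i) lam) H) P := fun i => by
    rw [hYφ i]
    exact HasLaw.comp ⟨(hφ i).aemeasurable, map_smsn_mixedModel hD (hS i) (Z i) μ lam (v i) H⟩
      (hlaw i)
  have hΨ : ∀ i, IsUnit (margDispersion D (S i) (Z i)).det := fun i =>
    (posDef_margDispersion hD.posSemidef (hS i) (Z i)).det_pos.ne'.isUnit
  refine ⟨?_, fun i => ⟨hlawY i, hasPDF_of_hasLaw_smsn (hΨ i) (hlawY i),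
    pdf_ae_eq_smsnPdf (hΨ i) (hlawY i)⟩⟩
  rw [funext hYφ]
  exact hindep.comp φ hφ

theorem mainTheorem1
    {Ω : Type*} [MeasurableSpace Ω] (P : Measure Ω) [IsProbabilityMeasure P]
    -- `N` subjects with `n i` observations each, `l` fixed and `q` random effects
    (N l q : ℕ) (n : Fin N → ℕ)
    -- the mixing distribution: the law of a positive random variable with `E[U^{-1/2}] < ∞`
    (H : Measure ℝ) [IsProbabilityMeasure H] (hHpos : ∀ᵐ u ∂H, 0 < u)
    (hHk : Integrable (fun u : ℝ => (√u)⁻¹) H)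
    -- design matrices and parameters
    (X : ∀ i, Matrix (Fin (n i)) (Fin l) ℝ) (Z : ∀ i, Matrix (Fin (n i)) (Fin q) ℝ)
    (β : Fin l → ℝ) (lam : Fin q → ℝ)
    (D : Matrix (Fin q) (Fin q) ℝ) (hD : D.PosDef)
    (S : ∀ i, Matrix (Fin (n i)) (Fin (n i)) ℝ) (hS : ∀ i, (S i).PosDef)
    -- random effects, errors and responses
    (b : Fin N → Ω → Fin q → ℝ) (ε : ∀ i, Ω → Fin (n i) → ℝ) (Y : ∀ i, Ω → Fin (n i) → ℝ)
    (hlaw : ∀ i, HasLaw (fun ω => Sum.elim (b i ω) (ε i ω))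
      (smsn (Sum.elim (centering H • bigDelta D lam) 0) (fromBlocks D 0 0 (S i))
        (Sum.elim lam 0) H) P)
    (hindep : iIndepFun
      (fun i ω => (Sum.elim (b i ω) (ε i ω) : Fin q ⊕ Fin (n i) → ℝ)) P)
    (hY : ∀ i ω, Y i ω = X i *ᵥ β + Z i *ᵥ b i ω + ε i ω) :
    iIndepFun Y P ∧
    ∀ i,
      HasLaw (Y i)
        (smsn (margLocation (X i) β (Z i) D lam H) (margDispersion D (S i) (Z i))
          (margSkewness D (S i) (Z i) lam) H) P ∧
      HasPDF (Y i) P volume ∧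
      pdf (Y i) P volume =ᵐ[volume] fun y =>
        2 * ∫⁻ u in Set.Ioi (0 : ℝ), ENNReal.ofReal
          (normalPdf (X i *ᵥ β + centering H • Z i *ᵥ bigDelta D lam)
              (u⁻¹ • margDispersion D (S i) (Z i)) y *
            stdNormalCdf (√u * (margSkewness D (S i) (Z i) lam ⬝ᵥ
              matInvSqrt (margDispersion D (S i) (Z i)) *ᵥ
                (y - X i *ᵥ β - centering H • Z i *ᵥ bigDelta D lam)))) ∂H := by
  simp_rw [sub_sub, margLocation, ← mulVec_smul]
  exact mainTheorem1_general P q n H Z (fun i => X i *ᵥ β) (centering H • bigDelta D lam) lam D hD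
    S hS b ε Y hlaw hindep hY
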